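/- Let $G$ be a finite tree (undirected, without loops) on $n \ge 1$ vertices, with $0/1$ adjacency matrix $A$, degree vector $d = A\mathbf 1$ and distance matrix $\Delta = (\delta_{i,j})$, where $\delta_{i,j}$ is the graph distance between the vertices $i$ and $j$. Let $k$ be a vertex of $G$, let $w > 0$ be real, and let $G(k,w)$ be the weighted graph obtained from $G$ by adding a loop of weight $w$ at $k$, i.e. the weighted graph with adjacency matrix $\hat A = A + w\, e_k e_k^{\top}$, where $e_k$ is the $k$-th unit vector. Let $P = \hat D^{-1}\hat A$, with $\hat D = \mathrm{diag}(\hat A \mathbf 1)$, be the transition matrix of the random walk on $G(k,w)$. For an irreducible stochastic matrix $P$ with stationary distribution $\pi$, Kemeny's constant is $\kappa(P) = \sum_{j} \pi_j\, m_{i,j}$, where $m_{i,j} = \mathbb E_i[\min\{t \ge 0 : X_t = j\}]$ is the expected time in which the Markov chain $(X_t)$ with transition matrix $P$ started at $i$ hits $j$ (so $m_{j,j}=0$); the sum does not depend on $i$. Put $\kappa(G(k,w)) = \kappa(P)$. Then $P$ is stochastic and irreducible, its Kemeny constant is well defined, and $$\kappa(G(k,w)) = \frac{d^{\top}\Delta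 d + 2w\, d^{\top}\Delta e_k}{2(2n-2+w)}.$$ -/

import Mathlib

open scoped Matrix

noncomputable section

namespace Kemeny

variable {V : Type*} [Fintype V] [DecidableEq V]

/-- The distance matrix of a graph. -/
def distMatrix (G : SimpleGraph V) : Matrix V V ℝ :=
  Matrix.of fun i j => (G.dist i j : ℝ)

/-- The (weighted) degree vector `A 𝟙` of the weighted graph with adjacency matrix `A`. -/
def degVec (A : Matrix V V ℝ) : V → ℝ := A *ᵥ 1

/-- The adjacency matrix of the weighted graph `G(k, w)`, obtained from the graph `G` by
adding a loop of weight `w` at the vertex `k`. -/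
def loopAdjMatrix (G : SimpleGraph V) [DecidableRel G.Adj] (k : V) (w : ℝ) : Matrix V V ℝ :=
  G.adjMatrix ℝ + Matrix.single k k w

/-- The transition matrix `P = D⁻¹ A`, `D = diag (A 𝟙)`, of the random walk on the weighted
graph with adjacency matrix `A`. -/
def transitionMatrix (A : Matrix V V ℝ) : Matrix V V ℝ :=
  Matrix.diagonal (fun i => (degVec A i)⁻¹) * A

/-- For the Markov chain `(X_t)` with transition matrix `P`, the probability, given `X_0 = i`,
that `X_0, …, X_t` all differ from `j`. This is the probability that `T_j > t`, where
`T_j = min {t ≥ 0 | X_t = j}` is the hitting time of `j`. -/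
def probNotHit (P : Matrix V V ℝ) (j : V) : ℕ → V → ℝ
  | 0, i => if i = j then 0 else 1
  | t + 1, i => if i = j then 0 else ∑ l, P i l * probNotHit P j t l

/-- `h` is the (finite) expected hitting time of `j` for the chain started at `i`:
`E_i[T_j] = ∑_{t ≥ 0} Pr_i(T_j > t)`. In particular it is `0` for `i = j`. -/
def HasMeanHittingTime (P : Matrix V V ℝ) (i j : V) (h : ℝ) : Prop :=
  HasSum (fun t : ℕ => probNotHit P j t i) h

/-- `π` is a stationary distribution of `P`. -/
def IsStationary (P : Matrix V V ℝ) (π : V → ℝ) : Prop :=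
  (∀ i, 0 ≤ π i) ∧ π ⬝ᵥ 1 = 1 ∧ π ᵥ* P = π

/-- `κ` is Kemeny's constant of the irreducible stochastic matrix `P`: from every initial state
`i`, the expected time to reach a state `j` chosen at random according to the stationary
distribution `π` is `∑ j, π j * E_i[T_j] = κ`. -/
def IsKemenyConstant (P : Matrix V V ℝ) (κ : ℝ) : Prop :=
  P ∈ Matrix.rowStochastic ℝ V ∧ P.IsIrreducible ∧
    ∃ (π : V → ℝ) (m : V → V → ℝ), IsStationary P π ∧
      (∀ i j, HasMeanHittingTime P i j (m i j)) ∧ ∀ i, ∑ j, π j * m i j = κ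

end Kemeny

end

/-!
A tree satisfies the Graham–Lovász identity `L Δ = (2 - d) 𝟙ᵀ - 2 I`, where `L` is the Laplacian:
seen from `i ≠ z`, exactly one neighbour is closer to `z` and all the others are farther away.
Loops do not change `L`, so for the random walk `P` on the tree with loops, of total degree `v`
and stationary distribution `π`, the matrix `R = (v / 2) Δ` solves `(1 - P) R = τ 𝟙ᵀ - diag(π)⁻¹`
for some vector `τ`. For any such `R`, the numbers `m i j = R i j + (R π) j - (R π) i` solve the
one-step equations of the mean hitting times, and averaging them over `j` with weights `π j`
leaves `πᵀ R π`, whatever `i` is.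
-/

namespace Kemeny

open Matrix

section HittingTime

variable {V : Type*} [Fintype V] {P : Matrix V V ℝ} {h : V → ℝ}

lemma mulVec_mono_of_nonneg (hP : ∀ i l, 0 ≤ P i l) {f g : V → ℝ} (hfg : f ≤ g) :
    P *ᵥ f ≤ P *ᵥ g :=
  fun i => Finset.sum_le_sum fun l _ => mul_le_mul_of_nonneg_left (hfg l) (hP i l)

variable [DecidableEq V] {j : V}

lemma probNotHit_self (P : Matrix V V ℝ) (j : V) (t : ℕ) : probNotHit P j t j = 0 := by
  cases t <;> simp [probNotHit]

lemma probNotHit_zero_of_ne (P : Matrix V V ℝ) {i : V} (hij : i ≠ j) : probNotHit P j 0 i = 1 :=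
  if_neg hij

lemma probNotHit_succ_of_ne (P : Matrix V V ℝ) {i : V} (hij : i ≠ j) (t : ℕ) :
    probNotHit P j (t + 1) i = (P *ᵥ probNotHit P j t) i :=
  if_neg hij

lemma probNotHit_nonneg (hP : ∀ i l, 0 ≤ P i l) (j : V) (t : ℕ) (i : V) :
    0 ≤ probNotHit P j t i := by
  induction t generalizing i with
  | zero => simp only [probNotHit]; split_ifs <;> norm_num
  | succ t ih =>
    simp only [probNotHit]
    split_ifs
    · rfl
    · exact Finset.sum_nonneg fun l _ => mul_nonneg (hP i l) (ih l)

lemma sub_sum_probNotHit_succ (hstep : ∀ i ≠ j, h i = 1 + (P *ᵥ h) i) {i : V} (hij : i ≠ j)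
    (t : ℕ) :
    (h - ∑ s ∈ Finset.range (t + 1), probNotHit P j s) i =
      (P *ᵥ (h - ∑ s ∈ Finset.range t, probNotHit P j s)) i := by
  simp only [mulVec_sub, mulVec_sum, Pi.sub_apply, Finset.sum_apply]
  rw [Finset.sum_range_succ', probNotHit_zero_of_ne P hij, hstep i hij]
  simp only [probNotHit_succ_of_ne P hij]
  ring

lemma sub_sum_probNotHit_mem_Icc (hP : ∀ i l, 0 ≤ P i l) (hnonneg : 0 ≤ h) (hj : h j = 0)
    (hstep : ∀ i ≠ j, h i = 1 + (P *ᵥ h) i) (t : ℕ) :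
    h - ∑ s ∈ Finset.range t, probNotHit P j s ∈ Set.Icc 0 ((∑ l, h l) • probNotHit P j t) := by
  induction t with
  | zero =>
    have hle_sum (i : V) : h i ≤ ∑ l, h l :=
      Finset.single_le_sum (fun l _ => hnonneg l) (Finset.mem_univ i)
    refine ⟨by simpa using hnonneg, fun i => ?_⟩
    rcases eq_or_ne i j with rfl | hij
    · simp [probNotHit_self, hj]
    · simpa [probNotHit_zero_of_ne P hij] using hle_sum i
  | succ t ih =>
    refine ⟨fun i => ?_, fun i => ?_⟩ <;> rcases eq_or_ne i j with rfl | hij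
    · simp [probNotHit_self, hj]
    · rw [sub_sum_probNotHit_succ hstep hij]
      simpa only [mulVec_zero] using mulVec_mono_of_nonneg hP ih.1 i
    · simp [probNotHit_self, hj]
    · rw [sub_sum_probNotHit_succ hstep hij, Pi.smul_apply, probNotHit_succ_of_ne P hij]
      simpa only [mulVec_smul, Pi.smul_apply] using mulVec_mono_of_nonneg hP ih.2 i

theorem hasMeanHittingTime_of_eq_one_add_mulVec (hP : ∀ i l, 0 ≤ P i l) (hnonneg : 0 ≤ h)
    (hj : h j = 0) (hstep : ∀ i ≠ j, h i = 1 + (P *ᵥ h) i) (i : V) :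
    HasMeanHittingTime P i j (h i) := by
  have hbound (t : ℕ) : h i - ∑ s ∈ Finset.range t, probNotHit P j s i ∈
      Set.Icc 0 ((∑ l, h l) * probNotHit P j t i) := by
    have := sub_sum_probNotHit_mem_Icc hP hnonneg hj hstep t
    simpa using And.intro (this.1 i) (this.2 i)
  have hsummable : Summable fun t => probNotHit P j t i :=
    summable_of_sum_range_le (fun t => probNotHit_nonneg hP j t i)
      fun t => sub_nonneg.mp (hbound t).1
  have hremainder : Filter.Tendsto (fun t => h i - ∑ s ∈ Finset.range t, probNotHit P j s i)
      Filter.atTop (nhds 0) := by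
    refine squeeze_zero (fun t => (hbound t).1) (fun t => (hbound t).2) ?_
    simpa using hsummable.tendsto_atTop_zero.const_mul (∑ l, h l)
  refine hsummable.hasSum_iff_tendsto_nat.mpr ?_
  simpa using hremainder.const_sub (h i)

end HittingTime

section KemenyConstant

variable {V : Type*} [Fintype V] {P R : Matrix V V ℝ} {π τ : V → ℝ}

/-- The candidate `m i j = R i j + (R π) j - (R π) i` for the matrix of mean hitting times of the
chain `P` with stationary distribution `π`. It is the right one if `R` vanishes on the diagonal,
satisfies the triangle inequality and solves `(1 - P) R = τ 𝟙ᵀ - diag(π)⁻¹` for some `τ`. -/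
def hittingMatrix (π : V → ℝ) (R : Matrix V V ℝ) : Matrix V V ℝ :=
  R + vecMulVec 1 (R *ᵥ π) - vecMulVec (R *ᵥ π) 1

lemma hittingMatrix_apply (π : V → ℝ) (R : Matrix V V ℝ) (i j : V) :
    hittingMatrix π R i j = R i j + (R *ᵥ π) j - (R *ᵥ π) i := by
  simp [hittingMatrix]

lemma hittingMatrix_nonneg (hπ : 0 ≤ π) (hπ_sum : π ⬝ᵥ 1 = 1)
    (htri : ∀ i j l, R i l ≤ R i j + R j l) (i j : V) : 0 ≤ hittingMatrix π R i j := by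
  have hRπ : (R *ᵥ π) i ≤ R i j + (R *ᵥ π) j :=
    calc (R *ᵥ π) i ≤ ∑ l, (R i j + R j l) * π l :=
          Finset.sum_le_sum fun l _ => mul_le_mul_of_nonneg_right (htri i j l) (hπ l)
      _ = R i j * (π ⬝ᵥ 1) + (R *ᵥ π) j := by
          rw [dotProduct_one, Finset.mul_sum, mulVec, dotProduct, ← Finset.sum_add_distrib]
          simp only [add_mul]
      _ = R i j + (R *ᵥ π) j := by rw [hπ_sum, mul_one]
  rw [hittingMatrix_apply]
  linarith

lemma sum_mul_hittingMatrix (hπ_sum : π ⬝ᵥ 1 = 1) (i : V) :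
    ∑ j, π j * hittingMatrix π R i j = π ⬝ᵥ (R *ᵥ π) :=
  calc ∑ j, π j * hittingMatrix π R i j
      = (R *ᵥ π) i + π ⬝ᵥ (R *ᵥ π) - (π ⬝ᵥ 1) * (R *ᵥ π) i := by
        simp only [hittingMatrix_apply, mul_sub, mul_add, Finset.sum_sub_distrib,
          Finset.sum_add_distrib, ← Finset.sum_mul, dotProduct_one]
        rw [mulVec, dotProduct_comm]
        rfl
    _ = π ⬝ᵥ (R *ᵥ π) := by rw [hπ_sum]; ring

variable [DecidableEq V]

lemma one_sub_mul_hittingMatrix (hP : P *ᵥ 1 = 1) (hπ_sum : π ⬝ᵥ 1 = 1) (hπ_ne : ∀ i, π i ≠ 0)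
    (hR : (1 - P) * R = vecMulVec τ 1 - diagonal π⁻¹) :
    (1 - P) * hittingMatrix π R = vecMulVec 1 1 - diagonal π⁻¹ := by
  have hone : (1 - P) *ᵥ 1 = 0 := by rw [sub_mulVec, one_mulVec, hP, sub_self]
  have hRπ : (1 - P) *ᵥ (R *ᵥ π) = τ - 1 := by
    rw [mulVec_mulVec, hR, sub_mulVec, vecMulVec_mulVec, dotProduct_comm, hπ_sum]
    ext i
    simp [mulVec_diagonal, hπ_ne i]
  rw [hittingMatrix, Matrix.mul_sub, Matrix.mul_add, mul_vecMulVec, mul_vecMulVec, hone, hRπ, hR,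
    zero_vecMulVec, sub_vecMulVec]
  abel

lemma hittingMatrix_eq_one_add_mulVec (hP : P *ᵥ 1 = 1) (hπ_sum : π ⬝ᵥ 1 = 1)
    (hπ_ne : ∀ i, π i ≠ 0) (hR : (1 - P) * R = vecMulVec τ 1 - diagonal π⁻¹) {i j : V}
    (hij : i ≠ j) :
    hittingMatrix π R i j = 1 + (P *ᵥ fun l => hittingMatrix π R l j) i := by
  have h := congrFun₂ (one_sub_mul_hittingMatrix hP hπ_sum hπ_ne hR) i j
  simp only [Matrix.sub_mul, Matrix.one_mul, Matrix.sub_apply, vecMulVec_apply, Pi.one_apply,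
    mul_one, diagonal_apply_ne _ hij, sub_zero] at h
  exact sub_eq_iff_eq_add.mp h

theorem isKemenyConstant_of_one_sub_mul (hP : P ∈ rowStochastic ℝ V) (hirr : P.IsIrreducible)
    (hπ : IsStationary P π) (hπ_ne : ∀ i, π i ≠ 0) (hdiag : ∀ i, R i i = 0)
    (htri : ∀ i j l, R i l ≤ R i j + R j l)
    (hR : (1 - P) * R = vecMulVec τ 1 - diagonal π⁻¹) :
    IsKemenyConstant P (π ⬝ᵥ (R *ᵥ π)) := by
  obtain ⟨hπ_nonneg, hπ_sum, -⟩ := id hπ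
  have hhit (i j : V) : HasMeanHittingTime P i j (hittingMatrix π R i j) :=
    hasMeanHittingTime_of_eq_one_add_mulVec (h := fun l => hittingMatrix π R l j) hirr.nonneg
      (fun l => hittingMatrix_nonneg hπ_nonneg hπ_sum htri l j)
      (by simp [hittingMatrix_apply, hdiag])
      (fun _ => hittingMatrix_eq_one_add_mulVec hP.2 hπ_sum hπ_ne hR) i
  exact ⟨hP, hirr, π, hittingMatrix π R, hπ, hhit, sum_mul_hittingMatrix hπ_sum⟩

end KemenyConstant

section Irreducible

variable {V : Type*} {A B : Matrix V V ℝ}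

lemma isIrreducible_of_pos_imp_pos (hA : A.IsIrreducible) (hB : ∀ i j, 0 ≤ B i j)
    (hAB : ∀ i j, 0 < A i j → 0 < B i j) : B.IsIrreducible := by
  refine ⟨hB, fun i j => ?_⟩
  let F := @Prefunctor.mk V A.toQuiver V B.toQuiver id fun e => ⟨hAB _ _ e.down⟩
  obtain ⟨p, hp⟩ := hA.connected i j
  cases p with
  | nil => exact absurd hp (lt_irrefl 0)
  | cons p e =>
    exact ⟨@Quiver.Path.cons V B.toQuiver _ _ _
      (@Prefunctor.mapPath V A.toQuiver V B.toQuiver F _ _ p) ⟨hAB _ _ e.down⟩, Nat.succ_pos _⟩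

lemma isIrreducible_of_adj_pos {G : SimpleGraph V} (hG : G.Preconnected) (hA : ∀ i j, 0 ≤ A i j)
    (hadj : ∀ i j, G.Adj i j → 0 < A i j) (hne : A ≠ 0) : A.IsIrreducible := by
  let : Quiver V := A.toQuiver
  let edge {i j : V} (hij : 0 < A i j) : i ⟶ j := ⟨hij⟩
  have hpath (i j : V) : Nonempty (Quiver.Path i j) := by
    obtain ⟨p⟩ := hG i j
    induction p with
    | nil => exact ⟨Quiver.Path.nil⟩
    | cons h _ ih => exact ih.map (edge (hadj _ _ h)).toPath.comp
  obtain ⟨a, b, hab⟩ : ∃ a b, 0 < A a b := by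
    by_contra! hle
    exact hne (Matrix.ext fun a b => (hle a b).antisymm (hA a b))
  refine ⟨hA, fun i j => ?_⟩
  obtain ⟨p⟩ := hpath i a
  obtain ⟨q⟩ := hpath b j
  exact ⟨(p.cons (edge hab)).comp q, by simp⟩

lemma exists_pos_of_isIrreducible (hA : A.IsIrreducible) (i : V) : ∃ l, 0 < A i l := by
  let : Quiver V := A.toQuiver
  obtain ⟨p, hp⟩ := hA.connected i i
  obtain ⟨l, e, -⟩ := (Quiver.Path.length_ne_zero_iff_eq_comp p).mp hp.ne'
  exact ⟨l, e.down⟩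

end Irreducible

section WeightedGraph

variable {V : Type*} [Fintype V] {A R : Matrix V V ℝ} {τ : V → ℝ}

lemma degVec_apply (A : Matrix V V ℝ) (i : V) : degVec A i = ∑ l, A i l := by
  simp [degVec, mulVec, dotProduct]

lemma degVec_pos_of_isIrreducible (hA : A.IsIrreducible) (i : V) : 0 < degVec A i := by
  obtain ⟨l, hl⟩ := exists_pos_of_isIrreducible hA i
  rw [degVec_apply]
  exact Finset.sum_pos' (fun l _ => hA.nonneg i l) ⟨l, Finset.mem_univ l, hl⟩

variable [DecidableEq V]

lemma transitionMatrix_apply (A : Matrix V V ℝ) (i l : V) :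
    transitionMatrix A i l = (degVec A i)⁻¹ * A i l := by
  simp [transitionMatrix, diagonal_mul]

lemma isIrreducible_transitionMatrix (hA : A.IsIrreducible) :
    (transitionMatrix A).IsIrreducible := by
  have hinv (i : V) : 0 < (degVec A i)⁻¹ := inv_pos.mpr (degVec_pos_of_isIrreducible hA i)
  refine isIrreducible_of_pos_imp_pos hA (fun i l => ?_) fun i l hl => ?_
  · rw [transitionMatrix_apply]
    exact mul_nonneg (hinv i).le (hA.nonneg i l)
  · rw [transitionMatrix_apply]
    exact mul_pos (hinv i) hl

lemma transitionMatrix_mulVec_one (hdeg : ∀ i, degVec A i ≠ 0) : transitionMatrix A *ᵥ 1 = 1 := by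
  rw [transitionMatrix, ← mulVec_mulVec]
  ext i
  exact (mulVec_diagonal _ _ i).trans (inv_mul_cancel₀ (hdeg i))

lemma isStationary_transitionMatrix [Nonempty V] (hA : A.IsSymm) (hdeg : ∀ i, 0 < degVec A i) :
    IsStationary (transitionMatrix A) ((∑ i, degVec A i)⁻¹ • degVec A) := by
  have hvol : 0 < ∑ i, degVec A i := Finset.sum_pos (fun i _ => hdeg i) Finset.univ_nonempty
  have hdeg_vecMul : degVec A ᵥ* diagonal (fun i => (degVec A i)⁻¹) = 1 := by
    ext i
    simp [vecMul_diagonal, (hdeg i).ne']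
  refine ⟨fun i => mul_nonneg (inv_nonneg.mpr hvol.le) (hdeg i).le, ?_, ?_⟩
  · rw [smul_dotProduct, dotProduct_one, smul_eq_mul, inv_mul_cancel₀ hvol.ne']
  · rw [smul_vecMul, transitionMatrix, ← vecMul_vecMul, hdeg_vecMul, ← mulVec_transpose, hA.eq,
      ← degVec]

lemma one_sub_transitionMatrix (hdeg : ∀ i, degVec A i ≠ 0) :
    1 - transitionMatrix A =
      diagonal (fun i => (degVec A i)⁻¹) * (diagonal (degVec A) - A) := by
  have hinv : diagonal (fun i => (degVec A i)⁻¹) * diagonal (degVec A) = 1 := by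
    simp [diagonal_mul_diagonal, hdeg]
  rw [Matrix.mul_sub, hinv, transitionMatrix]

lemma one_sub_transitionMatrix_mul_smul (hdeg : ∀ i, degVec A i ≠ 0)
    (hR : (diagonal (degVec A) - A) * R = vecMulVec τ 1 - 2) (v : ℝ) :
    (1 - transitionMatrix A) * ((v / 2) • R) =
      vecMulVec ((v / 2) • ((degVec A)⁻¹ * τ)) 1 - diagonal (v⁻¹ • degVec A)⁻¹ := by
  rw [one_sub_transitionMatrix hdeg, Matrix.mul_smul, Matrix.mul_assoc, hR]
  ext i j
  rcases eq_or_ne i j with rfl | hij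
  · simp only [Matrix.smul_apply, Matrix.sub_apply, vecMulVec_apply, diagonal_mul, ofNat_apply,
      diagonal_apply_eq, Pi.smul_apply, Pi.mul_apply, Pi.inv_apply, Pi.one_apply, smul_eq_mul,
      if_true, _root_.mul_inv_rev, inv_inv, Nat.cast_ofNat]
    ring
  · simp [Matrix.ofNat_apply, hij]

theorem isKemenyConstant_transitionMatrix [Nonempty V]
    (hA : A.IsSymm) (hirr : A.IsIrreducible) (hdiag : ∀ i, R i i = 0)
    (htri : ∀ i j l, R i l ≤ R i j + R j l)
    (hR : (diagonal (degVec A) - A) * R = vecMulVec τ 1 - 2) :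
    IsKemenyConstant (transitionMatrix A)
      (degVec A ⬝ᵥ (R *ᵥ degVec A) / (2 * ∑ i, degVec A i)) := by
  have hdeg := degVec_pos_of_isIrreducible hirr
  have hdeg_ne (i : V) : degVec A i ≠ 0 := (hdeg i).ne'
  set v := ∑ i, degVec A i with hv
  have hvol : 0 < v := Finset.sum_pos (fun i _ => hdeg i) Finset.univ_nonempty
  have hirr' := isIrreducible_transitionMatrix hirr
  convert isKemenyConstant_of_one_sub_mul ⟨hirr'.nonneg, transitionMatrix_mulVec_one hdeg_ne⟩
    hirr' (isStationary_transitionMatrix hA hdeg)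
    (fun i => mul_ne_zero (inv_ne_zero hvol.ne') (hdeg_ne i))
    (R := (v / 2) • R) (fun i => by simp [hdiag])
    (fun i j l => ?_) (one_sub_transitionMatrix_mul_smul hdeg_ne hR v) using 1
  · simp only [← hv, smul_dotProduct, dotProduct_smul, mulVec_smul, smul_mulVec, smul_eq_mul]
    field_simp
  · simpa [mul_add] using mul_le_mul_of_nonneg_left (htri i j l) (half_pos hvol).le

lemma degVec_add_diagonal (A : Matrix V V ℝ) (c : V → ℝ) :
    degVec (A + diagonal c) = degVec A + c := by
  rw [degVec, degVec, add_mulVec]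
  congr 1
  ext i
  simp [mulVec_diagonal]

lemma diagonal_degVec_sub_add_diagonal (A : Matrix V V ℝ) (c : V → ℝ) :
    diagonal (degVec (A + diagonal c)) - (A + diagonal c) = diagonal (degVec A) - A := by
  rw [degVec_add_diagonal, Pi.add_def, ← diagonal_add]
  abel

lemma dotProduct_mulVec_add_single {M : Matrix V V ℝ} (hM : M.IsSymm) {k : V} (hk : M k k = 0)
    (d : V → ℝ) (w : ℝ) :
    (d + Pi.single k w) ⬝ᵥ (M *ᵥ (d + Pi.single k w)) =
      d ⬝ᵥ (M *ᵥ d) + 2 * w * (d ⬝ᵥ (M *ᵥ Pi.single k 1)) := by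
  have hsymm : Pi.single k 1 ⬝ᵥ (M *ᵥ d) = d ⬝ᵥ (M *ᵥ Pi.single k 1) := by
    rw [dotProduct_mulVec, ← mulVec_transpose, hM.eq, dotProduct_comm]
  have hsingle : Pi.single k 1 ⬝ᵥ (M *ᵥ Pi.single k 1) = 0 := by simpa using hk
  have hsmul : (Pi.single k w : V → ℝ) = w • Pi.single k 1 := by
    rw [← Pi.single_smul, smul_eq_mul, mul_one]
  simp only [hsmul, mulVec_add, mulVec_smul, dotProduct_add, add_dotProduct, smul_dotProduct,
    dotProduct_smul, smul_eq_mul, hsymm, hsingle]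
  ring

end WeightedGraph

section Tree

variable {V : Type*} {G : SimpleGraph V}

lemma existsUnique_adj_dist_eq_add_one (hG : G.IsTree) {i z : V} (hiz : i ≠ z) :
    ∃! u, G.Adj i u ∧ G.dist i z = G.dist u z + 1 := by
  obtain ⟨p, hp, hp_length⟩ := hG.connected.exists_path_of_dist i z
  have hp_nil : ¬ p.Nil := SimpleGraph.Walk.not_nil_of_ne hiz
  refine ⟨p.snd, ⟨p.adj_snd hp_nil, ?_⟩, fun u ⟨hu, hu_dist⟩ => ?_⟩
  · have hsnd := SimpleGraph.dist_le p.tail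
    have hlength := SimpleGraph.Walk.length_tail_add_one hp_nil
    have htri := (p.adj_snd hp_nil).reachable.dist_triangle_left z
    rw [SimpleGraph.dist_eq_one_iff_adj.mpr (p.adj_snd hp_nil)] at htri
    omega
  · obtain ⟨q, -, hq⟩ := hG.connected.exists_path_of_dist u z
    have hcons : (SimpleGraph.Walk.cons hu q).IsPath :=
      SimpleGraph.Walk.isPath_of_length_eq_dist _ (by simp [hq, hu_dist])
    rw [← (hG.existsUnique_path i z).unique hcons hp, SimpleGraph.Walk.snd_cons]

lemma dist_eq_or_dist_eq_of_adj (hG : G.IsTree) {i u : V} (hu : G.Adj i u) (z : V) :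
    G.dist i z = G.dist u z + 1 ∨ G.dist u z = G.dist i z + 1 := by
  simpa only [G.dist_comm (u := z)] using hG.dist_eq_dist_add_one_of_adj z hu

lemma isSymm_distMatrix (G : SimpleGraph V) : (distMatrix G).IsSymm := by
  ext i j
  simp [distMatrix, G.dist_comm]

lemma distMatrix_apply_self (G : SimpleGraph V) (i : V) : distMatrix G i i = 0 := by
  simp [distMatrix]

lemma distMatrix_triangle (hG : G.Connected) (i j l : V) :
    distMatrix G i l ≤ distMatrix G i j + distMatrix G j l := by
  simpa [distMatrix] using mod_cast hG.dist_triangle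

variable [Fintype V] [DecidableRel G.Adj]

lemma sum_neighborFinset_dist (hG : G.IsTree) {i z : V} (hiz : i ≠ z) :
    ∑ l ∈ G.neighborFinset i, (G.dist l z : ℝ) = G.degree i * (G.dist i z + 1) - 2 := by
  classical
  obtain ⟨u, ⟨hu, hu_dist⟩, hu_unique⟩ := existsUnique_adj_dist_eq_add_one hG hiz
  have hdist : ∀ l ∈ G.neighborFinset i,
      (G.dist l z : ℝ) = G.dist i z + 1 - if l = u then 2 else 0 := by
    intro l hl
    have hil := (G.mem_neighborFinset i l).mp hl
    split_ifs with hlu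
    · rw [hlu, hu_dist]
      push_cast
      ring
    · have hfar := (dist_eq_or_dist_eq_of_adj hG hil z).resolve_left
        fun h => hlu (hu_unique l ⟨hil, h⟩)
      rw [hfar]
      push_cast
      ring
  rw [Finset.sum_congr rfl hdist, Finset.sum_sub_distrib, Finset.sum_ite_eq',
    if_pos ((G.mem_neighborFinset i u).mpr hu), Finset.sum_const, nsmul_eq_mul,
    G.card_neighborFinset_eq_degree]

lemma degVec_adjMatrix (G : SimpleGraph V) [DecidableRel G.Adj] :
    degVec (G.adjMatrix ℝ) = fun i => (G.degree i : ℝ) := by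
  ext i
  simp [degVec]

lemma sum_degVec_adjMatrix (hG : G.IsTree) :
    ∑ i, degVec (G.adjMatrix ℝ) i = 2 * (Fintype.card V : ℝ) - 2 := by
  have hdegrees : ∑ i, (G.degree i : ℝ) = 2 * G.edgeFinset.card :=
    mod_cast G.sum_degrees_eq_twice_card_edges
  have hcard : (G.edgeFinset.card : ℝ) + 1 = Fintype.card V := mod_cast hG.card_edgeFinset
  rw [degVec_adjMatrix, hdegrees, ← hcard]
  ring

variable [DecidableEq V]

lemma diagonal_degVec_adjMatrix_sub (G : SimpleGraph V) [DecidableRel G.Adj] :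
    diagonal (degVec (G.adjMatrix ℝ)) - G.adjMatrix ℝ = G.lapMatrix ℝ := by
  rw [degVec_adjMatrix, SimpleGraph.lapMatrix, SimpleGraph.degMatrix]

theorem lapMatrix_mul_distMatrix (hG : G.IsTree) :
    G.lapMatrix ℝ * distMatrix G = vecMulVec (2 - degVec (G.adjMatrix ℝ)) 1 - 2 := by
  ext i z
  have hentry : (G.lapMatrix ℝ * distMatrix G) i z =
      G.degree i * G.dist i z - ∑ l ∈ G.neighborFinset i, (G.dist l z : ℝ) :=
    G.lapMatrix_mulVec_apply i fun l => (G.dist l z : ℝ)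
  rw [hentry, degVec_adjMatrix]
  rcases eq_or_ne i z with rfl | hiz
  · have hnbr : ∀ l ∈ G.neighborFinset i, (G.dist l i : ℝ) = 1 := fun l hl => by
      rw [SimpleGraph.dist_eq_one_iff_adj.mpr ((G.mem_neighborFinset i l).mp hl).symm, Nat.cast_one]
    simp [Finset.sum_congr rfl hnbr, Matrix.ofNat_apply]
  · rw [sum_neighborFinset_dist hG hiz]
    simp only [Matrix.sub_apply, vecMulVec_apply, ofNat_apply, hiz, Pi.sub_apply, Pi.ofNat_apply,
      if_false, Nat.cast_zero, sub_zero, mul_one]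
    ring

end Tree

section Loops

variable {V : Type*} [DecidableEq V] {G : SimpleGraph V} [DecidableRel G.Adj]

lemma loopAdjMatrix_eq_add_diagonal (G : SimpleGraph V) [DecidableRel G.Adj] (k : V) (w : ℝ) :
    loopAdjMatrix G k w = G.adjMatrix ℝ + diagonal (Pi.single k w) := by
  rw [loopAdjMatrix, diagonal_single]

variable [Fintype V]

lemma isIrreducible_adjMatrix_add_diagonal (hG : G.Preconnected) {c : V → ℝ} (hc : 0 ≤ c)
    (hvol : 0 < ∑ i, degVec (G.adjMatrix ℝ + diagonal c) i) :
    (G.adjMatrix ℝ + diagonal c).IsIrreducible := by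
  have hdiag (i j : V) : 0 ≤ diagonal c i j := by
    rw [diagonal_apply]
    split_ifs
    exacts [hc i, le_rfl]
  have hnonneg (i j : V) : 0 ≤ (G.adjMatrix ℝ + diagonal c) i j :=
    add_nonneg (by rw [SimpleGraph.adjMatrix_apply]; split_ifs <;> norm_num) (hdiag i j)
  have hadj (i j : V) (hij : G.Adj i j) : 0 < (G.adjMatrix ℝ + diagonal c) i j :=
    add_pos_of_pos_of_nonneg (by simp [hij]) (hdiag i j)
  refine isIrreducible_of_adj_pos hG hnonneg hadj fun hzero => ?_
  simp [hzero, degVec] at hvol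

end Loops

end Kemeny

theorem mainTheorem6_general {V : Type*} [Fintype V] [DecidableEq V]
    (G : SimpleGraph V) [DecidableRel G.Adj] (hG : G.IsTree) (c : V → ℝ) (hc : 0 ≤ c)
    (hvol : 0 < 2 * (Fintype.card V : ℝ) - 2 + ∑ i, c i) :
    Kemeny.IsKemenyConstant
      (Kemeny.transitionMatrix (G.adjMatrix ℝ + Matrix.diagonal c))
      ((Kemeny.degVec (G.adjMatrix ℝ) + c) ⬝ᵥ
          (Kemeny.distMatrix G *ᵥ (Kemeny.degVec (G.adjMatrix ℝ) + c)) /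
        (2 * (2 * (Fintype.card V : ℝ) - 2 + ∑ i, c i))) := by
  have : Nonempty V := hG.connected.nonempty
  have hsum : ∑ i, Kemeny.degVec (G.adjMatrix ℝ + Matrix.diagonal c) i =
      2 * (Fintype.card V : ℝ) - 2 + ∑ i, c i := by
    simp only [Kemeny.degVec_add_diagonal, Pi.add_apply, Finset.sum_add_distrib,
      Kemeny.sum_degVec_adjMatrix hG]
  rw [← hsum] at hvol ⊢
  rw [← Kemeny.degVec_add_diagonal]
  refine Kemeny.isKemenyConstant_transitionMatrix
    (G.isSymm_adjMatrix.add (Matrix.isSymm_diagonal c))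
    (Kemeny.isIrreducible_adjMatrix_add_diagonal hG.connected.preconnected hc hvol)
    (Kemeny.distMatrix_apply_self G) (Kemeny.distMatrix_triangle hG.connected)
    (τ := 2 - Kemeny.degVec (G.adjMatrix ℝ)) ?_
  rw [Kemeny.diagonal_degVec_sub_add_diagonal, Kemeny.diagonal_degVec_adjMatrix_sub,
    Kemeny.lapMatrix_mul_distMatrix hG]


theorem mainTheorem6 {V : Type*} [Fintype V] [DecidableEq V]
    (G : SimpleGraph V) [DecidableRel G.Adj] (hG : G.IsTree) (k : V) (w : ℝ) (hw : 0 < w) :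
    Kemeny.IsKemenyConstant
      (Kemeny.transitionMatrix (Kemeny.loopAdjMatrix G k w))
      ((Kemeny.degVec (G.adjMatrix ℝ) ⬝ᵥ
            (Kemeny.distMatrix G *ᵥ Kemeny.degVec (G.adjMatrix ℝ)) +
          2 * w * (Kemeny.degVec (G.adjMatrix ℝ) ⬝ᵥ
            (Kemeny.distMatrix G *ᵥ (Pi.single k 1 : V → ℝ)))) /
        (2 * (2 * (Fintype.card V : ℝ) - 2 + w))) := by
  have hn : (1 : ℝ) ≤ Fintype.card V := mod_cast Fintype.card_pos_iff.mpr ⟨k⟩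
  rw [Kemeny.loopAdjMatrix_eq_add_diagonal, ← Kemeny.dotProduct_mulVec_add_single
    (Kemeny.isSymm_distMatrix G) (Kemeny.distMatrix_apply_self G k)]
  simpa using mainTheorem6_general G hG (Pi.single k w) (Pi.single_nonneg.mpr hw.le)
    (by rw [Finset.sum_pi_single' k w, if_pos (Finset.mem_univ k)]; linarith)
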